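/- Let $M$ be a smooth Riemannian manifold of dimension $d$ with metric $ds^2_M=\langle\cdot,\cdot\rangle$, and let $G$ be a group acting transitively on $M$ by smooth Riemannian isometries. For $\bar x\in M$ let $K_{\bar x}$ be the stabiliser of $\bar x$ in $G$, and assume that $M$ is irreducible, that is, the isotropy representation $k\mapsto dk|_{\bar x}$ of $K_{\bar x}$ on $T_{\bar x}M$ is irreducible for every $\bar x$ (so $d\ge 1$); if $d=1$, assume in addition that this representation is not trivial (for $d\ge 2$ this is automatic). Let $\mathcal M=M\times(0,\infty)$ and for each $z=(\bar x,\sigma)\in\mathcal M$ let $p(\cdot\,|\,z)=p(\cdot\,|\,\bar x,\sigma)$ be a probability density on $M$ with respect to the Riemannian volume. Write $\mathbb E_z$ for the expectation with respect to $p(\cdot\,|\,z)$ and $\ell(z)=\log p(x\,|\,z)$. Assume that the model is regular: for every $z\in\mathcal M$, the function $p(x\,|\,\cdot)$ is differentiable at $z$ for $p(\cdot\,|\,z)$-almost every $x$; and for every tangent vector $v\in T_z\mathcal M$ the score $x\mapsto d\ell(z)(v)$ is square integrable with respect to $p(\cdot\,|\,z)$, and if $v\neq 0$ it is not almost everywhere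 zero. The Rao–Fisher metric of the model is $$I_z(v,w)=\mathbb E_z\big[d\ell(z)(v)\,d\ell(z)(w)\big],\qquad v,w\in T_z\mathcal M .$$ Assume finally that $p(g\cdot x\,|\,g\cdot\bar x,\sigma)=p(x\,|\,\bar x,\sigma)$ for all $g\in G$, $x,\bar x\in M$ and $\sigma>0$. **Theorem (warped metrics).** The two expectations $$I_0(\sigma)=\mathbb E_z\big(\partial_\sigma\ell(z)\big)^2,\qquad I_1(\sigma)=\frac{1}{d}\,\mathbb E_z\big\Vert\nabla_{\bar x}\ell(z)\big\Vert^2,\qquad z=(\bar x,\sigma),$$ where $\nabla_{\bar x}$ is the Riemannian gradient with respect to $\bar x\in M$, do not depend on $\bar x$ and are strictly positive, and the Rao–Fisher metric is the warped metric $$ds^2(z)=I_0(\sigma)\,d\sigma^2+I_1(\sigma)\,ds^2_M(\bar x).$$ Moreover, for each $r\in\{0,1,2,\dots,\infty\}$, if the Rao–Fisher metric is of class $C^r$ on $\mathcal M$, then $I_0$ and $I_1$ are of class $C^r$ on $(0,\infty)$. -/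

import Mathlib

open Set MeasureTheory Bundle
open scoped Manifold ContDiff Bundle

noncomputable section

namespace WarpedMetrics

section Geometry

variable {d : ℕ} {M : Type*} [TopologicalSpace M] [ChartedSpace (EuclideanSpace ℝ (Fin d)) M]

/-- Tangent spaces of a `d`-dimensional manifold are finite-dimensional. -/
instance finiteDimensional_tangentSpace (x : M) :
    FiniteDimensional ℝ (TangentSpace (𝓡 d) x) :=
  inferInstanceAs (FiniteDimensional ℝ (EuclideanSpace ℝ (Fin d)))

section Volume

variable [RiemannianBundle (fun x : M ↦ TangentSpace (𝓡 d) x)]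

/-- The Gram matrix `g_ij` of the coordinate vector fields `∂_i = d(e⁻¹) e_i` of a chart `e`, at
the point with coordinates `u`. -/
def chartGram (e : OpenPartialHomeomorph M (EuclideanSpace ℝ (Fin d)))
    (u : EuclideanSpace ℝ (Fin d)) : Matrix (Fin d) (Fin d) ℝ :=
  Matrix.of fun i j ↦ inner ℝ
    (mfderiv (𝓡 d) (𝓡 d) e.symm u (EuclideanSpace.single i (1 : ℝ) : EuclideanSpace ℝ (Fin d)))
    (mfderiv (𝓡 d) (𝓡 d) e.symm u (EuclideanSpace.single j (1 : ℝ) : EuclideanSpace ℝ (Fin d)))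

/-- The Riemannian volume element `√(det g_ij) du¹ ⋯ du^d` in the domain of a chart `e`, as a
measure on `M` carried by the domain of `e`. -/
def chartVolume [MeasurableSpace M]
    (e : OpenPartialHomeomorph M (EuclideanSpace ℝ (Fin d))) : Measure M :=
  ((volume.restrict e.target).withDensity
    (fun u ↦ ENNReal.ofReal (Real.sqrt (chartGram e u).det))).map e.symm

variable (d M) in
/-- The Riemannian volume measure: the smallest measure that dominates the volume element of every
smooth chart. By the change of variables formula the volume elements of two charts agree on the
intersection of their domains, so (on a second countable manifold) this is the unique measure
whose restriction to the domain of each chart is `√(det g_ij) du¹ ⋯ du^d`. -/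
def riemannianVolume [MeasurableSpace M] : Measure M :=
  ⨆ e ∈ IsManifold.maximalAtlas (𝓡 d) ∞ M, chartVolume e

/-- The Riemannian gradient at `x` of a real function `f` on `M`: the tangent vector that
represents the differential of `f` at `x`. -/
def riemannianGradient (f : M → ℝ) (x : M) : TangentSpace (𝓡 d) x :=
  haveI : CompleteSpace (TangentSpace (𝓡 d) x) := FiniteDimensional.complete ℝ _
  (InnerProductSpace.toDual ℝ (TangentSpace (𝓡 d) x)).symm (mfderiv (𝓡 d) 𝓘(ℝ, ℝ) f x)

end Volume

section Action

variable (d M) (G : Type*) [Group G] [MulAction G M]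

/-- `G` acts on `M` by smooth maps. -/
def IsSmoothAction : Prop :=
  ∀ g : G, ContMDiff (𝓡 d) (𝓡 d) ∞ (fun x : M ↦ g • x)

/-- `G` acts on `M` by maps whose differentials preserve the Riemannian metric. -/
def PreservesMetric [RiemannianBundle (fun x : M ↦ TangentSpace (𝓡 d) x)] : Prop :=
  ∀ (g : G) (x : M) (v w : TangentSpace (𝓡 d) x),
    inner ℝ (mfderiv (𝓡 d) (𝓡 d) (fun y : M ↦ g • y) x v)
      (mfderiv (𝓡 d) (𝓡 d) (fun y : M ↦ g • y) x w) = inner ℝ v w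

variable {d M G}

/-- The differential at `x` of an element of the stabiliser of `x`, as an endomorphism of the
tangent space at `x`. -/
def isotropyMap (x : M) (k : MulAction.stabilizer G x) :
    TangentSpace (𝓡 d) x →ₗ[ℝ] TangentSpace (𝓡 d) x :=
  (mfderiv (𝓡 d) (𝓡 d) (fun y : M ↦ (k : G) • y) x :
    EuclideanSpace ℝ (Fin d) →L[ℝ] EuclideanSpace ℝ (Fin d)).toLinearMap

/-- The isotropy representation `k ↦ dk|ₓ` of the stabiliser of `x` in the tangent space at `x`. -/
def isotropyRepresentation (hG : IsSmoothAction d M G) (x : M) :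
    Representation ℝ (MulAction.stabilizer G x) (TangentSpace (𝓡 d) x) where
  toFun := isotropyMap x
  map_one' := by
    have h1 : (fun y : M ↦ ((1 : MulAction.stabilizer G x) : G) • y) = id := by
      funext y
      simp
    refine LinearMap.ext fun v ↦ ?_
    unfold isotropyMap
    rw [h1, mfderiv_id]
    rfl
  map_mul' k l := by
    have hx : (l : G) • x = x := l.2
    have hd (g : G) (y : M) : MDifferentiableAt (𝓡 d) (𝓡 d) (fun z : M ↦ g • z) y :=
      (hG g).mdifferentiableAt (by simp)
    have hkl : (fun z : M ↦ ((k * l : MulAction.stabilizer G x) : G) • z)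
        = (fun z : M ↦ (k : G) • z) ∘ (fun z : M ↦ (l : G) • z) := by
      funext z
      simp [mul_smul]
    refine LinearMap.ext fun v ↦ ?_
    unfold isotropyMap
    have hk : ∀ y : M, y = x →
        (mfderiv (𝓡 d) (𝓡 d) (fun z : M ↦ (k : G) • z) y :
          EuclideanSpace ℝ (Fin d) →L[ℝ] EuclideanSpace ℝ (Fin d)) =
        (mfderiv (𝓡 d) (𝓡 d) (fun z : M ↦ (k : G) • z) x :
          EuclideanSpace ℝ (Fin d) →L[ℝ] EuclideanSpace ℝ (Fin d)) := by
      rintro y rfl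
      rfl
    rw [hkl, mfderiv_comp x (hd (k : G) ((l : G) • x)) (hd (l : G) x)]
    exact congrArg (fun L : EuclideanSpace ℝ (Fin d) →L[ℝ] EuclideanSpace ℝ (Fin d) ↦
      L (mfderiv (𝓡 d) (𝓡 d) (fun z : M ↦ (l : G) • z) x v)) (hk _ hx)

end Action

end Geometry

section Statistics

variable {d : ℕ} {M : Type*} [TopologicalSpace M] [ChartedSpace (EuclideanSpace ℝ (Fin d)) M]

/-- The model with corners of `M × (0, ∞)`, seen as the open subset `{z | 0 < z.2}` of `M × ℝ`. -/
abbrev paramModel (d : ℕ) := (𝓡 d).prod 𝓘(ℝ, ℝ)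

/-- The log-likelihood `ℓ(z) = log p(x | x̄, σ)` at the observation `x`, where `z = (x̄, σ)`. -/
def logLik (p : M → M → ℝ → ℝ) (x : M) (z : M × ℝ) : ℝ := Real.log (p x z.1 z.2)

/-- The score `dℓ(z)(v)`: the derivative of the log-likelihood at `z` along the tangent vector `v`
of the parameter manifold. -/
def score (p : M → M → ℝ → ℝ) (z : M × ℝ) (v : TangentSpace (paramModel d) z) (x : M) : ℝ :=
  mfderiv (paramModel d) 𝓘(ℝ, ℝ) (logLik p x) z v

variable [RiemannianBundle (fun x : M ↦ TangentSpace (𝓡 d) x)] [MeasurableSpace M]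

variable (d) in
/-- The measure on `M` with density `p(· | z)` with respect to the Riemannian volume; `E_z` is the
integral against it. -/
def law (p : M → M → ℝ → ℝ) (z : M × ℝ) : Measure M :=
  (riemannianVolume d M).withDensity (fun x ↦ ENNReal.ofReal (p x z.1 z.2))

/-- The Rao–Fisher metric `I_z(v, w) = E_z [dℓ(z)(v) dℓ(z)(w)]`. -/
def raoFisher (p : M → M → ℝ → ℝ) (z : M × ℝ) (v w : TangentSpace (paramModel d) z) : ℝ :=
  ∫ x, score p z v x * score p z w x ∂(law d p z)

variable (d) in
/-- `p` is a regular statistical model on `M` with parameter manifold `M × (0, ∞)`: each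
`p(· | z)` is a probability density with respect to the Riemannian volume, and the usual conditions
hold under which the Rao–Fisher metric is defined and non-degenerate. -/
structure IsRegularModel (p : M → M → ℝ → ℝ) : Prop where
  measurable : ∀ z : M × ℝ, 0 < z.2 → Measurable (fun x ↦ p x z.1 z.2)
  nonneg : ∀ (x : M) (z : M × ℝ), 0 < z.2 → 0 ≤ p x z.1 z.2
  isProbability : ∀ z : M × ℝ, 0 < z.2 → IsProbabilityMeasure (law d p z)
  /-- for almost every observation the density is differentiable in the parameter -/
  differentiable : ∀ z : M × ℝ, 0 < z.2 → ∀ᵐ x ∂(law d p z),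
    MDifferentiableAt (paramModel d) 𝓘(ℝ, ℝ) (fun y : M × ℝ ↦ p x y.1 y.2) z
  /-- finite Fisher information -/
  memLp_score : ∀ z : M × ℝ, 0 < z.2 → ∀ v : TangentSpace (paramModel d) z,
    MemLp (score p z v) 2 (law d p z)
  /-- the score map is injective, up to almost everywhere equality -/
  score_ne_zero : ∀ z : M × ℝ, 0 < z.2 → ∀ v : TangentSpace (paramModel d) z, v ≠ 0 →
    ¬ score p z v =ᵐ[law d p z] 0

/-- The differential `dσ` of the coordinate `σ` on the parameter manifold. -/
def dSigma (z : M × ℝ) (v : TangentSpace (paramModel d) z) : ℝ :=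
  mfderiv (paramModel d) 𝓘(ℝ, ℝ) (Prod.snd : M × ℝ → ℝ) z v

/-- The warped form `I₀(σ) dσ² + I₁(σ) ds²_M(x̄)` at `z = (x̄, σ)`, polarised. -/
def warped (I₀ I₁ : ℝ → ℝ) (z : M × ℝ) (v w : TangentSpace (paramModel d) z) : ℝ :=
  I₀ z.2 * (dSigma z v * dSigma z w) +
    I₁ z.2 * inner ℝ (mfderiv (paramModel d) (𝓡 d) (Prod.fst : M × ℝ → M) z v)
      (mfderiv (paramModel d) (𝓡 d) (Prod.fst : M × ℝ → M) z w)

end Statistics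

/-- A field `F` of forms on the tangent spaces of `M × (0, ∞)` is of class `C^r`: it takes `C^r`
values on `C^r` local vector fields. -/
def IsContMDiffForm {d : ℕ} {M : Type*} [TopologicalSpace M]
    [ChartedSpace (EuclideanSpace ℝ (Fin d)) M] [IsManifold (𝓡 d) ∞ M] (r : ℕ∞)
    (F : ∀ z : M × ℝ, TangentSpace (paramModel d) z → TangentSpace (paramModel d) z → ℝ) : Prop :=
  ∀ U : Set (M × ℝ), IsOpen U → (∀ z ∈ U, 0 < z.2) →
    ∀ X Y : ∀ z : M × ℝ, TangentSpace (paramModel d) z,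
      ContMDiffOn (paramModel d) (paramModel d).tangent r
        (fun z ↦ (⟨z, X z⟩ : TangentBundle (paramModel d) (M × ℝ))) U →
      ContMDiffOn (paramModel d) (paramModel d).tangent r
        (fun z ↦ (⟨z, Y z⟩ : TangentBundle (paramModel d) (M × ℝ))) U →
      ContMDiffOn (paramModel d) 𝓘(ℝ, ℝ) r (fun z ↦ F z (X z) (Y z)) U

end WarpedMetrics

end

/-! The Rao–Fisher metric inherits the symmetry of the model, and symmetry under an irreducible
isotropy group leaves only two free coefficients at each `σ`.

Isometries preserve the Riemannian volume (`map_smul_riemannianVolume`): translating a chart by `g`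
gives another smooth chart with the same Gram matrix. With the invariance of `p`, this makes the
laws and the scores equivariant, so the Rao–Fisher metric is invariant under `G` acting on the
factor `M` (`raoFisher_smul`).

At `(y, σ)` the stabiliser of `y` acts on `T_y M ⊕ ℝ`, trivially on the second summand. The mixed
block is an invariant linear form on an irreducible representation; its kernel is invariant, so it
vanishes (`linearForm_eq_zero_of_invariant`). The block on `T_y M` is an invariant symmetric form,
hence a multiple of the inner product by Schur's lemma (`exists_eq_mul_inner_of_invariant`).
Transitivity carries the two coefficients to every point of `M`.

Evaluation on `∂_σ` and on an orthonormal basis of `T_y M` identifies the coefficients with the two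
expectations. Evaluation on vectors with constant components along a line `{y} × (0, ∞)` shows that
they are as smooth as the metric. -/

noncomputable section

namespace WarpedMetrics

/-! ### Invariant linear and bilinear forms on irreducible representations -/

section LinearAlgebra

variable {K V : Type*} [Group K]

/-- A linear form that is invariant under an irreducible representation vanishes, unless the
representation is trivial of dimension one. -/
theorem linearForm_eq_zero_of_invariant [AddCommGroup V] [Module ℝ V]
    (ρ : Representation ℝ K V) (hρ : ρ.IsIrreducible)
    (hone : Module.finrank ℝ V = 1 → ∃ k, ρ k ≠ 1) (f : V →ₗ[ℝ] ℝ)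
    (hf : ∀ k v, f (ρ k v) = f v) : f = 0 := by
  let S : Subrepresentation ρ := ⟨LinearMap.ker f, fun k v hv ↦ by
    simpa [LinearMap.mem_ker, hf] using hv⟩
  rcases hρ.eq_bot_or_eq_top S with h | h
  · exfalso
    have hker : LinearMap.ker f = ⊥ := congrArg Subrepresentation.toSubmodule h
    have hinj : Function.Injective f := LinearMap.ker_eq_bot.mp hker
    have hfin : FiniteDimensional ℝ V := FiniteDimensional.of_injective f hinj
    have hnt : Nontrivial V := by
      by_contra hV
      rw [not_nontrivial_iff_subsingleton] at hV
      have hne : (⊥ : Subrepresentation ρ) ≠ ⊤ := bot_ne_top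
      exact hne (Subrepresentation.toSubmodule_injective (Subsingleton.elim _ _))
    have hle : Module.finrank ℝ V ≤ 1 := by
      simpa using LinearMap.finrank_le_finrank_of_injective hinj
    have hpos : 0 < Module.finrank ℝ V := Module.finrank_pos
    -- An injective invariant form forces every `ρ k` to be the identity, which is excluded in
    -- dimension one.
    obtain ⟨k, hk⟩ := hone (by omega)
    exact hk (LinearMap.ext fun v ↦ hinj (hf k v))
  · exact LinearMap.ker_eq_top.mp (congrArg Subrepresentation.toSubmodule h)

/-- **Schur's lemma for quadratic forms**: a symmetric bilinear form that is invariant under an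
irreducible orthogonal representation is a multiple of the inner product. -/
theorem exists_eq_mul_inner_of_invariant [NormedAddCommGroup V] [InnerProductSpace ℝ V]
    [FiniteDimensional ℝ V] (ρ : Representation ℝ K V) (hρ : ρ.IsIrreducible)
    (horth : ∀ k v w, inner ℝ (ρ k v) (ρ k w) = inner ℝ v w) (B : V →ₗ[ℝ] V →ₗ[ℝ] ℝ)
    (hsymm : ∀ v w, B v w = B w v) (hB : ∀ k v w, B (ρ k v) (ρ k w) = B v w) :
    ∃ c : ℝ, ∀ v w, B v w = c * inner ℝ v w := by
  have hnt : Nontrivial V := by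
    by_contra hV
    rw [not_nontrivial_iff_subsingleton] at hV
    have hne : (⊥ : Subrepresentation ρ) ≠ ⊤ := bot_ne_top
    exact hne (Subrepresentation.toSubmodule_injective (Subsingleton.elim _ _))
  have : CompleteSpace V := FiniteDimensional.complete ℝ _
  -- `A` represents `B` through the inner product. It is self-adjoint, so it has a real eigenvalue,
  -- and irreducibility makes the eigenspace everything.
  let A : V →ₗ[ℝ] V :=
    { toFun := fun v ↦ (InnerProductSpace.toDual ℝ V).symm (B v).toContinuousLinearMap
      map_add' := fun v w ↦ by simp
      map_smul' := fun c v ↦ by simp }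
  have hA (v w : V) : inner ℝ (A v) w = B v w :=
    InnerProductSpace.toDual_symm_apply
  have hAsymm : A.IsSymmetric := fun v w ↦ by
    rw [hA, real_inner_comm, hA, hsymm]
  obtain ⟨c, hc⟩ : ∃ c : ℝ, Module.End.HasEigenvalue A c :=
    ⟨_, hAsymm.hasEigenvalue_iSup_of_finiteDimensional⟩
  obtain ⟨u, hu⟩ := hc.exists_hasEigenvector
  -- Described through `B` and the inner product, both invariant, the eigenspace is visibly stable
  -- under `ρ`.
  have hcomp (v : V) : v ∈ Module.End.eigenspace A c ↔ ∀ w, B v w = c * inner ℝ v w := by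
    rw [Module.End.mem_eigenspace_iff]
    constructor
    · intro h w
      rw [← hA, h, real_inner_smul_left]
    · intro h
      refine ext_inner_right ℝ fun w ↦ ?_
      rw [hA, h, real_inner_smul_left]
  let S : Subrepresentation ρ := ⟨Module.End.eigenspace A c, fun k v hv ↦ by
    rw [hcomp] at hv ⊢
    intro w
    have hw : w = ρ k (ρ k⁻¹ w) := by simp
    rw [hw, hB, horth, hv]⟩
  rcases hρ.eq_bot_or_eq_top S with h | h
  · have hbot : Module.End.eigenspace A c = ⊥ := congrArg Subrepresentation.toSubmodule h
    exact absurd hbot hc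
  · have htop : Module.End.eigenspace A c = ⊤ := congrArg Subrepresentation.toSubmodule h
    exact ⟨c, fun v ↦ (hcomp v).mp (htop ▸ Submodule.mem_top)⟩

end LinearAlgebra

/-! ### Invariance of the Riemannian volume under isometries -/

section Volume

variable {d : ℕ} {M : Type*} [TopologicalSpace M] [ChartedSpace (EuclideanSpace ℝ (Fin d)) M]
  {G : Type*} [Group G] [MulAction G M]

/-- A smooth action is an action by homeomorphisms. -/
def IsSmoothAction.homeomorph (hG : IsSmoothAction d M G) (g : G) : M ≃ₜ M where
  toEquiv := MulAction.toPerm g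
  continuous_toFun := (hG g).continuous
  continuous_invFun := (hG g⁻¹).continuous

theorem IsSmoothAction.mdifferentiableAt (hG : IsSmoothAction d M G) (g : G) (x : M) :
    MDifferentiableAt (𝓡 d) (𝓡 d) (fun y : M ↦ g • y) x :=
  (hG g).mdifferentiableAt (by simp)

/-- The translate of a chart by a group element. -/
def IsSmoothAction.translateChart (hG : IsSmoothAction d M G) (g : G)
    (e : OpenPartialHomeomorph M (EuclideanSpace ℝ (Fin d))) :
    OpenPartialHomeomorph M (EuclideanSpace ℝ (Fin d)) :=
  (hG.homeomorph g).symm.transOpenPartialHomeomorph e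

theorem IsSmoothAction.translateChart_mem_maximalAtlas [IsManifold (𝓡 d) ∞ M]
    (hG : IsSmoothAction d M G) (g : G) {e : OpenPartialHomeomorph M (EuclideanSpace ℝ (Fin d))}
    (he : e ∈ IsManifold.maximalAtlas (𝓡 d) ∞ M) :
    hG.translateChart g e ∈ IsManifold.maximalAtlas (𝓡 d) ∞ M := by
  refine OpenPartialHomeomorph.mem_maximalAtlas_of_contMDiffOn (I := 𝓡 d) (n := ∞) _ ?_ ?_
  · exact (contMDiffOn_of_mem_maximalAtlas he).comp (hG g⁻¹).contMDiffOn fun x hx ↦ hx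
  · exact (hG g).comp_contMDiffOn (contMDiffOn_symm_of_mem_maximalAtlas he)

variable [RiemannianBundle (fun x : M ↦ TangentSpace (𝓡 d) x)]

theorem chartGram_translateChart (hG : IsSmoothAction d M G) (hmetric : PreservesMetric d M G)
    [IsManifold (𝓡 d) ∞ M] (g : G) {e : OpenPartialHomeomorph M (EuclideanSpace ℝ (Fin d))}
    (he : e ∈ IsManifold.maximalAtlas (𝓡 d) ∞ M) {u : EuclideanSpace ℝ (Fin d)}
    (hu : u ∈ e.target) : chartGram (hG.translateChart g e) u = chartGram e u := by
  have hd : MDifferentiableAt (𝓡 d) (𝓡 d) e.symm u :=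
    (contMDiffAt_symm_of_mem_maximalAtlas he hu).mdifferentiableAt (by simp)
  have hderiv := mfderiv_comp u (hG.mdifferentiableAt g (e.symm u)) hd
  ext i j
  -- Reading differentials as maps of the model space lets the chain rule be applied under the inner
  -- product; the base points agree by definition.
  let Q (L : EuclideanSpace ℝ (Fin d) →L[ℝ] EuclideanSpace ℝ (Fin d)) : ℝ :=
    @inner ℝ (TangentSpace (𝓡 d) (g • e.symm u)) _ (L (EuclideanSpace.single i (1 : ℝ)))
      (L (EuclideanSpace.single j (1 : ℝ)))
  exact (congrArg Q hderiv).trans (hmetric g (e.symm u) _ _)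

variable [MeasurableSpace M] [BorelSpace M]

/-- Both measures are images of the same density on the same target, since the Gram matrices agree
there; only the inverse chart acquires the factor `g`. -/
theorem map_smul_chartVolume (hG : IsSmoothAction d M G) (hmetric : PreservesMetric d M G)
    [IsManifold (𝓡 d) ∞ M] (g : G) {e : OpenPartialHomeomorph M (EuclideanSpace ℝ (Fin d))}
    (he : e ∈ IsManifold.maximalAtlas (𝓡 d) ∞ M) :
    (chartVolume e).map (fun x ↦ g • x) = chartVolume (hG.translateChart g e) := by
  have hmeas : Measurable (fun x : M ↦ g • x) := (hG g).continuous.measurable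
  unfold chartVolume
  have hsymm : AEMeasurable e.symm ((volume.restrict e.target).withDensity
      (fun u ↦ ENNReal.ofReal (Real.sqrt (chartGram e u).det))) :=
    (e.continuousOn_symm.aemeasurable e.open_target.measurableSet).mono_ac
      (withDensity_absolutelyContinuous _ _)
  rw [AEMeasurable.map_map_of_aemeasurable hmeas.aemeasurable hsymm]
  have hdens : (volume.restrict e.target).withDensity
      (fun u ↦ ENNReal.ofReal (Real.sqrt (chartGram e u).det)) =
      (volume.restrict e.target).withDensity
      (fun u ↦ ENNReal.ofReal (Real.sqrt (chartGram (hG.translateChart g e) u).det)) := by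
    refine withDensity_congr_ae ?_
    filter_upwards [ae_restrict_mem e.open_target.measurableSet] with u hu
    rw [chartGram_translateChart hG hmetric g he hu]
  rw [hdens]
  rfl

/-- Each chart volume is the image under `g` of the volume of the chart translated by `g⁻¹`, which
the supremum dominates. Applying the bound to `g⁻¹` will give the converse. -/
theorem riemannianVolume_le_map_smul (hG : IsSmoothAction d M G) (hmetric : PreservesMetric d M G)
    [IsManifold (𝓡 d) ∞ M] (g : G) :
    riemannianVolume d M ≤ (riemannianVolume d M).map (fun x ↦ g • x) := by
  have hmeas (h : G) : Measurable (fun x : M ↦ h • x) := (hG h).continuous.measurable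
  refine iSup₂_le fun e he ↦ ?_
  have hle : chartVolume (hG.translateChart g⁻¹ e) ≤ riemannianVolume d M :=
    le_iSup₂_of_le (hG.translateChart g⁻¹ e) (hG.translateChart_mem_maximalAtlas g⁻¹ he) le_rfl
  have hmap := Measure.map_mono hle (hmeas g)
  rw [← map_smul_chartVolume hG hmetric g⁻¹ he, Measure.map_map (hmeas g) (hmeas g⁻¹)] at hmap
  have hid : (fun x : M ↦ g • x) ∘ (fun x ↦ g⁻¹ • x) = id := by
    funext x
    simp
  rwa [hid, Measure.map_id] at hmap

/-- The Riemannian volume is invariant under smooth isometries. -/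
theorem map_smul_riemannianVolume (hG : IsSmoothAction d M G) (hmetric : PreservesMetric d M G)
    [IsManifold (𝓡 d) ∞ M] (g : G) :
    (riemannianVolume d M).map (fun x ↦ g • x) = riemannianVolume d M := by
  have hmeas (h : G) : Measurable (fun x : M ↦ h • x) := (hG h).continuous.measurable
  refine le_antisymm ?_ (riemannianVolume_le_map_smul hG hmetric g)
  have hmap := Measure.map_mono (riemannianVolume_le_map_smul hG hmetric g⁻¹) (hmeas g)
  rw [Measure.map_map (hmeas g) (hmeas g⁻¹)] at hmap
  have hid : (fun x : M ↦ g • x) ∘ (fun x ↦ g⁻¹ • x) = id := by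
    funext x
    simp
  rwa [hid, Measure.map_id] at hmap

end Volume

/-! ### Equivariance of scores and laws, and the blocks of the Rao–Fisher metric -/

section Invariance

variable {d : ℕ} {M : Type*} [TopologicalSpace M] [ChartedSpace (EuclideanSpace ℝ (Fin d)) M]
  {G : Type*} [Group G] [MulAction G M]

/-- The tangent vector to `M × ℝ` at `(y, σ)` with components `a` and `t`. -/
def tangentPair {y : M} (σ : ℝ) (a : TangentSpace (𝓡 d) y) (t : ℝ) :
    TangentSpace (paramModel d) ((y, σ) : M × ℝ) :=
  ((a, t) : EuclideanSpace ℝ (Fin d) × ℝ)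

theorem exists_eq_tangentPair {y : M} {σ : ℝ}
    (v : TangentSpace (paramModel d) ((y, σ) : M × ℝ)) :
    ∃ (a : TangentSpace (𝓡 d) y) (t : ℝ), v = tangentPair σ a t :=
  ⟨(show EuclideanSpace ℝ (Fin d) × ℝ from v).1, (show EuclideanSpace ℝ (Fin d) × ℝ from v).2, rfl⟩

theorem dSigma_tangentPair {y : M} (σ : ℝ) (a : TangentSpace (𝓡 d) y) (t : ℝ) :
    dSigma (d := d) (y, σ) (tangentPair σ a t) = t := by
  unfold dSigma
  rw [mfderiv_snd]
  rfl

theorem mfderiv_fst_tangentPair {y : M} (σ : ℝ) (a : TangentSpace (𝓡 d) y) (t : ℝ) :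
    mfderiv (paramModel d) (𝓡 d) (Prod.fst : M × ℝ → M) (y, σ) (tangentPair σ a t) = a := by
  rw [mfderiv_fst]
  rfl

theorem score_tangentPair (p : M → M → ℝ → ℝ) {y : M} (σ : ℝ) (a : TangentSpace (𝓡 d) y) (t : ℝ)
    (x : M) : score p (y, σ) (tangentPair σ a t) x =
      score p (y, σ) (tangentPair σ a 0) x +
        t * score p (y, σ) (tangentPair σ (0 : TangentSpace (𝓡 d) y) 1) x := by
  let L : EuclideanSpace ℝ (Fin d) × ℝ →L[ℝ] ℝ := mfderiv (paramModel d) 𝓘(ℝ, ℝ) (logLik p x) (y, σ)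
  let b : EuclideanSpace ℝ (Fin d) := a
  have h : L (b, t) = L (b, 0) + t * L (0, 1) := by
    rw [← smul_eq_mul, ← map_smul, ← map_add]
    simp
  exact h

theorem score_tangentPair_add (p : M → M → ℝ → ℝ) {y : M} (σ : ℝ) (a b : TangentSpace (𝓡 d) y)
    (x : M) : score p (y, σ) (tangentPair σ (a + b) 0) x =
      score p (y, σ) (tangentPair σ a 0) x + score p (y, σ) (tangentPair σ b 0) x := by
  let L : EuclideanSpace ℝ (Fin d) × ℝ →L[ℝ] ℝ := mfderiv (paramModel d) 𝓘(ℝ, ℝ) (logLik p x) (y, σ)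
  let a' : EuclideanSpace ℝ (Fin d) := a
  let b' : EuclideanSpace ℝ (Fin d) := b
  have h : L (a' + b', 0) = L (a', 0) + L (b', 0) := by
    rw [← map_add]
    simp
  exact h

theorem score_tangentPair_smul (p : M → M → ℝ → ℝ) {y : M} (σ c : ℝ) (a : TangentSpace (𝓡 d) y)
    (x : M) : score p (y, σ) (tangentPair σ (c • a) 0) x =
      c * score p (y, σ) (tangentPair σ a 0) x := by
  let L : EuclideanSpace ℝ (Fin d) × ℝ →L[ℝ] ℝ := mfderiv (paramModel d) 𝓘(ℝ, ℝ) (logLik p x) (y, σ)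
  let a' : EuclideanSpace ℝ (Fin d) := a
  have h : L (c • a', 0) = c * L (a', 0) := by
    rw [← smul_eq_mul, ← map_smul]
    simp
  exact h

/-- The score is invariant under a group that leaves the density invariant. -/
theorem score_smul (hG : IsSmoothAction d M G) {p : M → M → ℝ → ℝ}
    (hinv : ∀ (g : G) (x y : M) (σ : ℝ), 0 < σ → p (g • x) (g • y) σ = p x y σ)
    (g : G) (x y : M) {σ : ℝ} (hσ : 0 < σ)
    (hd : MDifferentiableAt (paramModel d) 𝓘(ℝ, ℝ) (logLik p (g • x)) (g • y, σ))
    (a : TangentSpace (𝓡 d) y) (t : ℝ) :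
    score p (g • y, σ) (tangentPair σ (mfderiv (𝓡 d) (𝓡 d) (fun y' : M ↦ g • y') y a) t) (g • x) =
      score p (y, σ) (tangentPair σ a t) x := by
  let Φ : M × ℝ → M × ℝ := Prod.map (fun y' ↦ g • y') id
  have hΦ : HasMFDerivAt (paramModel d) (paramModel d) Φ (y, σ) _ :=
    HasMFDerivAt.prodMap (hG.mdifferentiableAt g y).hasMFDerivAt (hasMFDerivAt_id σ)
  -- Invariance is assumed only for positive `σ`, an open condition, so the identity holds near `(y,
  -- σ)` and can be differentiated there.
  have hev : logLik p x =ᶠ[nhds (y, σ)] logLik p (g • x) ∘ Φ := by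
    have hopen : IsOpen {z : M × ℝ | 0 < z.2} := isOpen_lt continuous_const continuous_snd
    filter_upwards [hopen.mem_nhds (show (y, σ) ∈ {z : M × ℝ | 0 < z.2} from hσ)] with z hz
    exact congrArg Real.log (hinv g x z.1 z.2 hz).symm
  have hcomp : HasMFDerivAt (paramModel d) 𝓘(ℝ, ℝ) (logLik p x) (y, σ) _ :=
    (HasMFDerivAt.comp (y, σ) (g := logLik p (g • x)) hd.hasMFDerivAt hΦ).congr_of_eventuallyEq hev
  unfold score
  rw [hcomp.mfderiv, mfderiv_id]
  rfl

variable [RiemannianBundle (fun x : M ↦ TangentSpace (𝓡 d) x)] [MeasurableSpace M]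

/-- The law of an invariant model is equivariant. -/
theorem law_smul [BorelSpace M] [IsManifold (𝓡 d) ∞ M] (hG : IsSmoothAction d M G)
    (hmetric : PreservesMetric d M G) {p : M → M → ℝ → ℝ} (hp : IsRegularModel d p)
    (hinv : ∀ (g : G) (x y : M) (σ : ℝ), 0 < σ → p (g • x) (g • y) σ = p x y σ)
    (g : G) (y : M) {σ : ℝ} (hσ : 0 < σ) :
    law d p (g • y, σ) = (law d p (y, σ)).map (fun x ↦ g • x) := by
  have hmeas : Measurable (fun x : M ↦ g • x) := (hG g).continuous.measurable
  ext s hs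
  rw [Measure.map_apply hmeas hs]
  unfold law
  rw [withDensity_apply _ hs, withDensity_apply _ (hmeas hs)]
  conv_lhs => rw [← map_smul_riemannianVolume hG hmetric g]
  rw [setLIntegral_map hs (hp.measurable (g • y, σ) hσ).ennreal_ofReal hmeas]
  simp only [hinv g _ y σ hσ]

/-- The zero set of a density is null for its own law, so the logarithm is almost surely taken at a
nonzero value. -/
theorem IsRegularModel.mdifferentiableAt_logLik {p : M → M → ℝ → ℝ} (hp : IsRegularModel d p)
    (y : M) {σ : ℝ} (hσ : 0 < σ) : ∀ᵐ x ∂(law d p (y, σ)),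
      MDifferentiableAt (paramModel d) 𝓘(ℝ, ℝ) (logLik p x) (y, σ) := by
  have hpos : ∀ᵐ x ∂(law d p (y, σ)), p x y σ ≠ 0 := by
    unfold law
    rw [ae_withDensity_iff (hp.measurable (y, σ) hσ).ennreal_ofReal]
    refine Filter.Eventually.of_forall fun x hx h0 ↦ hx ?_
    simp [h0]
  filter_upwards [hpos, hp.differentiable (y, σ) hσ] with x hx hd
  exact (Real.differentiableAt_log hx).mdifferentiableAt.comp (y, σ) hd

/-- The Rao–Fisher metric of an invariant model is invariant. -/
theorem raoFisher_smul [BorelSpace M] [IsManifold (𝓡 d) ∞ M] (hG : IsSmoothAction d M G)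
    (hmetric : PreservesMetric d M G) {p : M → M → ℝ → ℝ} (hp : IsRegularModel d p)
    (hinv : ∀ (g : G) (x y : M) (σ : ℝ), 0 < σ → p (g • x) (g • y) σ = p x y σ)
    (g : G) (y : M) {σ : ℝ} (hσ : 0 < σ) (a b : TangentSpace (𝓡 d) y) (s t : ℝ) :
    raoFisher p (g • y, σ)
        (tangentPair σ (mfderiv (𝓡 d) (𝓡 d) (fun y' : M ↦ g • y') y a) s)
        (tangentPair σ (mfderiv (𝓡 d) (𝓡 d) (fun y' : M ↦ g • y') y b) t) =
      raoFisher p (y, σ) (tangentPair σ a s) (tangentPair σ b t) := by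
  have hemb : MeasurableEmbedding (fun x : M ↦ g • x) :=
    (hG.homeomorph g).measurableEmbedding
  have hae := hp.mdifferentiableAt_logLik (g • y) hσ
  unfold raoFisher
  -- As the law at `g • y` is an image measure, differentiability holds at `g • x` for almost every
  -- `x` under the law at `y`.
  rw [law_smul hG hmetric hp hinv g y hσ] at hae ⊢
  rw [hemb.integral_map]
  refine integral_congr_ae ?_
  filter_upwards [ae_of_ae_map hemb.measurable.aemeasurable hae] with x hx
  rw [score_smul hG hinv g x y hσ hx, score_smul hG hinv g x y hσ hx]

theorem IsRegularModel.integrable_score_mul {p : M → M → ℝ → ℝ} (hp : IsRegularModel d p)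
    {z : M × ℝ} (hz : 0 < z.2) (v w : TangentSpace (paramModel d) z) :
    Integrable (fun x ↦ score p z v x * score p z w x) (law d p z) :=
  (hp.memLp_score z hz v).integrable_mul (hp.memLp_score z hz w)

theorem raoFisher_comm (p : M → M → ℝ → ℝ) (z : M × ℝ) (v w : TangentSpace (paramModel d) z) :
    raoFisher p z v w = raoFisher p z w v := by
  unfold raoFisher
  simp only [mul_comm]

theorem IsRegularModel.raoFisher_pos {p : M → M → ℝ → ℝ} (hp : IsRegularModel d p)
    {z : M × ℝ} (hz : 0 < z.2) {v : TangentSpace (paramModel d) z} (hv : v ≠ 0) :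
    0 < raoFisher p z v v := by
  have hnonneg : 0 ≤ fun x ↦ score p z v x * score p z v x := fun x ↦ mul_self_nonneg _
  refine lt_of_le_of_ne (integral_nonneg hnonneg) fun h ↦ hp.score_ne_zero z hz v hv ?_
  have h0 := (integral_eq_zero_iff_of_nonneg hnonneg (hp.integrable_score_mul hz v v)).mp h.symm
  filter_upwards [h0] with x hx
  exact mul_self_eq_zero.mp hx

/-- The Rao–Fisher metric restricted to the directions tangent to `M`. -/
def raoFisherFiber {p : M → M → ℝ → ℝ} (hp : IsRegularModel d p) (y : M) {σ : ℝ} (hσ : 0 < σ) :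
    TangentSpace (𝓡 d) y →ₗ[ℝ] TangentSpace (𝓡 d) y →ₗ[ℝ] ℝ :=
  have hi (a b : TangentSpace (𝓡 d) y) :=
    hp.integrable_score_mul (z := (y, σ)) hσ (tangentPair σ a 0) (tangentPair σ b 0)
  LinearMap.mk₂ ℝ
    (fun a b ↦ raoFisher p (y, σ) (tangentPair σ a 0) (tangentPair σ b 0))
    (fun a a' b ↦ by
      unfold raoFisher
      rw [← integral_add (hi a b) (hi a' b)]
      simp only [score_tangentPair_add, add_mul])
    (fun c a b ↦ by
      unfold raoFisher
      rw [smul_eq_mul, ← integral_const_mul]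
      simp only [score_tangentPair_smul, mul_assoc])
    (fun a b b' ↦ by
      unfold raoFisher
      rw [← integral_add (hi a b) (hi a b')]
      simp only [score_tangentPair_add, mul_add])
    (fun c a b ↦ by
      unfold raoFisher
      rw [smul_eq_mul, ← integral_const_mul]
      simp only [score_tangentPair_smul, mul_left_comm])

/-- The mixed part of the Rao–Fisher metric, as a linear form on the tangent spaces of `M`. -/
def raoFisherMixed {p : M → M → ℝ → ℝ} (hp : IsRegularModel d p) (y : M) {σ : ℝ} (hσ : 0 < σ) :
    TangentSpace (𝓡 d) y →ₗ[ℝ] ℝ :=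
  have hi (a : TangentSpace (𝓡 d) y) :=
    hp.integrable_score_mul (z := (y, σ)) hσ (tangentPair σ a 0) (tangentPair σ 0 1)
  { toFun := fun a ↦ raoFisher p (y, σ) (tangentPair σ a 0) (tangentPair σ 0 1)
    map_add' := fun a a' ↦ by
      unfold raoFisher
      rw [← integral_add (hi a) (hi a')]
      simp only [score_tangentPair_add, add_mul]
    map_smul' := fun c a ↦ by
      unfold raoFisher
      rw [RingHom.id_apply, smul_eq_mul, ← integral_const_mul]
      simp only [score_tangentPair_smul, mul_assoc] }

/-- Bilinear expansion into blocks; square integrability of the scores allows the integral to be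
split. -/
theorem IsRegularModel.raoFisher_tangentPair {p : M → M → ℝ → ℝ} (hp : IsRegularModel d p) (y : M)
    {σ : ℝ} (hσ : 0 < σ) (a b : TangentSpace (𝓡 d) y) (s t : ℝ) :
    raoFisher p (y, σ) (tangentPair σ a s) (tangentPair σ b t) =
      raoFisherFiber hp y hσ a b + t * raoFisherMixed hp y hσ a + s * raoFisherMixed hp y hσ b +
        s * t * raoFisher p (y, σ) (tangentPair σ (0 : TangentSpace (𝓡 d) y) 1)
          (tangentPair σ (0 : TangentSpace (𝓡 d) y) 1) := by
  have hi (a b : TangentSpace (𝓡 d) y) (s t : ℝ) :=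
    hp.integrable_score_mul (z := (y, σ)) hσ (tangentPair σ a s) (tangentPair σ b t)
  change raoFisher _ _ _ _ = raoFisher _ _ _ _ + t * raoFisher _ _ _ _ + s * raoFisher _ _ _ _ + _
  unfold raoFisher
  have h₁ := hi a b 0 0
  have h₂ := (hi a 0 0 1).const_mul t
  have h₃ := (hi b 0 0 1).const_mul s
  have h₄ := (hi 0 0 1 1).const_mul (s * t)
  simp only [← integral_const_mul]
  rw [← integral_add h₁ h₂, ← integral_add ?_ h₃, ← integral_add ?_ h₄]
  rotate_left
  · exact (h₁.add h₂).add h₃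
  · exact h₁.add h₂
  refine integral_congr_ae (Filter.Eventually.of_forall fun x ↦ ?_)
  simp only [score_tangentPair p σ a s, score_tangentPair p σ b t]
  ring

end Invariance

/-! ### Schur's lemma applied to the isotropy representation -/

section WarpedForm

variable {d : ℕ} {M : Type*} [TopologicalSpace M] [ChartedSpace (EuclideanSpace ℝ (Fin d)) M]

section Schur

variable {G : Type*} [Group G] [MulAction G M]
  [RiemannianBundle (fun x : M ↦ TangentSpace (𝓡 d) x)]

/-- For `k` in the stabiliser, `k • x = x` is not definitional; this moves inner products between
the two tangent spaces, which share one model space. -/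
theorem inner_eq_of_point_eq {x y : M} (h : x = y) (a b : EuclideanSpace ℝ (Fin d)) :
    @inner ℝ (TangentSpace (𝓡 d) x) _ a b = @inner ℝ (TangentSpace (𝓡 d) y) _ a b := by
  subst h
  rfl

theorem inner_isotropyRepresentation (hG : IsSmoothAction d M G) (hmetric : PreservesMetric d M G)
    (x : M) (k : MulAction.stabilizer G x) (v w : TangentSpace (𝓡 d) x) :
    inner ℝ (isotropyRepresentation hG x k v) (isotropyRepresentation hG x k w) = inner ℝ v w :=
  (inner_eq_of_point_eq (show (k : G) • x = x from k.2) _ _).symm.trans (hmetric k x v w)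

variable [MeasurableSpace M]

theorem raoFisher_eq_of_point_eq (p : M → M → ℝ → ℝ) {x y : M} (h : x = y) (σ : ℝ)
    (a b : EuclideanSpace ℝ (Fin d)) (s t : ℝ) :
    raoFisher p (x, σ) (tangentPair σ (y := x) a s) (tangentPair σ (y := x) b t) =
      raoFisher p (y, σ) (tangentPair σ (y := y) a s) (tangentPair σ (y := y) b t) := by
  subst h
  rfl

variable [BorelSpace M] [IsManifold (𝓡 d) ∞ M]

theorem raoFisher_isotropyRepresentation (hG : IsSmoothAction d M G)
    (hmetric : PreservesMetric d M G) {p : M → M → ℝ → ℝ} (hp : IsRegularModel d p)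
    (hinv : ∀ (g : G) (x y : M) (σ : ℝ), 0 < σ → p (g • x) (g • y) σ = p x y σ)
    (y : M) (k : MulAction.stabilizer G y) {σ : ℝ} (hσ : 0 < σ) (a b : TangentSpace (𝓡 d) y)
    (s t : ℝ) :
    raoFisher p (y, σ) (tangentPair σ (isotropyRepresentation hG y k a) s)
        (tangentPair σ (isotropyRepresentation hG y k b) t) =
      raoFisher p (y, σ) (tangentPair σ a s) (tangentPair σ b t) :=
  (raoFisher_eq_of_point_eq p (show (k : G) • y = y from k.2) σ _ _ s t).symm.trans
    (raoFisher_smul hG hmetric hp hinv k y hσ a b s t)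

/-- At each point, the Rao–Fisher metric of an invariant model on an irreducible space is a
combination of `dσ²` and the Riemannian metric. -/
theorem exists_raoFisher_eq_at (hG : IsSmoothAction d M G)
    (hmetric : PreservesMetric d M G) {p : M → M → ℝ → ℝ} (hp : IsRegularModel d p)
    (hinv : ∀ (g : G) (x y : M) (σ : ℝ), 0 < σ → p (g • x) (g • y) σ = p x y σ)
    (y : M) (hirr : (isotropyRepresentation hG y).IsIrreducible)
    (hone : d = 1 → ∃ k : MulAction.stabilizer G y, isotropyRepresentation hG y k ≠ 1)
    {σ : ℝ} (hσ : 0 < σ) :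
    ∃ i₀ i₁ : ℝ, ∀ (a b : TangentSpace (𝓡 d) y) (s t : ℝ),
      raoFisher p (y, σ) (tangentPair σ a s) (tangentPair σ b t) =
        i₀ * (s * t) + i₁ * inner ℝ a b := by
  obtain ⟨c, hc⟩ := exists_eq_mul_inner_of_invariant (isotropyRepresentation hG y) hirr
    (inner_isotropyRepresentation hG hmetric y) (raoFisherFiber hp y hσ)
    (fun a b ↦ raoFisher_comm p _ _ _)
    (fun k a b ↦ raoFisher_isotropyRepresentation hG hmetric hp hinv y k hσ a b 0 0)
  have hfin : Module.finrank ℝ (TangentSpace (𝓡 d) y) = d :=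
    finrank_euclideanSpace_fin (𝕜 := ℝ) (n := d)
  have hmixed : raoFisherMixed hp y hσ = 0 := by
    refine linearForm_eq_zero_of_invariant (isotropyRepresentation hG y) hirr
      (fun h ↦ hone (hfin.symm.trans h)) _ fun k a ↦ ?_
    -- Pairing `(a, 0)` with `∂_σ = (0, 1)`, which the isotropy action fixes, shows that the mixed
    -- block is an invariant form.
    have h := raoFisher_isotropyRepresentation hG hmetric hp hinv y k hσ a 0 0 1
    rw [map_zero] at h
    exact h
  refine ⟨raoFisher p (y, σ) (tangentPair σ (0 : TangentSpace (𝓡 d) y) 1)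
    (tangentPair σ (0 : TangentSpace (𝓡 d) y) 1), c, fun a b s t ↦ ?_⟩
  rw [hp.raoFisher_tangentPair y hσ, hc, hmixed]
  simp only [LinearMap.zero_apply]
  ring

/-- On a homogeneous space, the coefficients of the Rao–Fisher metric of an invariant model do not
depend on the point. -/
theorem exists_raoFisher_eq [Nonempty M] [MulAction.IsPretransitive G M]
    (hG : IsSmoothAction d M G)
    (hmetric : PreservesMetric d M G) {p : M → M → ℝ → ℝ} (hp : IsRegularModel d p)
    (hinv : ∀ (g : G) (x y : M) (σ : ℝ), 0 < σ → p (g • x) (g • y) σ = p x y σ)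
    (hirr : ∀ y : M, (isotropyRepresentation hG y).IsIrreducible)
    (hone : d = 1 → ∀ y : M, ∃ k : MulAction.stabilizer G y, isotropyRepresentation hG y k ≠ 1)
    {σ : ℝ} (hσ : 0 < σ) :
    ∃ i₀ i₁ : ℝ, ∀ (y : M) (a b : TangentSpace (𝓡 d) y) (s t : ℝ),
      raoFisher p (y, σ) (tangentPair σ a s) (tangentPair σ b t) =
        i₀ * (s * t) + i₁ * inner ℝ a b := by
  obtain ⟨y₀⟩ := ‹Nonempty M›
  obtain ⟨i₀, i₁, h⟩ :=
    exists_raoFisher_eq_at hG hmetric hp hinv y₀ (hirr y₀) (fun hd ↦ hone hd y₀) hσ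
  refine ⟨i₀, i₁, fun y a b s t ↦ ?_⟩
  obtain ⟨g, rfl⟩ := MulAction.exists_smul_eq G y y₀
  rw [← raoFisher_smul hG hmetric hp hinv g y hσ a b s t, h, hmetric]

end Schur

/-! ### The coefficients as expectations -/

section Expectations

/-- Chain rule along the curve `s ↦ (y, s)`; joint differentiability is what ties the partial
derivative to the score. -/
theorem deriv_logLik (p : M → M → ℝ → ℝ) {x y : M} {σ : ℝ}
    (hd : MDifferentiableAt (paramModel d) 𝓘(ℝ, ℝ) (logLik p x) (y, σ)) :
    deriv (fun s : ℝ ↦ logLik p x (y, s)) σ =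
      score p (y, σ) (tangentPair σ (0 : TangentSpace (𝓡 d) y) 1) x := by
  have hcurve : HasMFDerivAt 𝓘(ℝ, ℝ) (paramModel d) (fun s : ℝ ↦ (y, s)) σ _ :=
    (hasMFDerivAt_const (I' := 𝓡 d) y σ).prodMk (hasMFDerivAt_id σ)
  have h : HasMFDerivAt 𝓘(ℝ, ℝ) 𝓘(ℝ, ℝ) (fun s : ℝ ↦ logLik p x (y, s)) σ _ :=
    HasMFDerivAt.comp σ (g := logLik p x) hd.hasMFDerivAt hcurve
  rw [← fderiv_apply_one_eq_deriv, ← mfderiv_eq_fderiv, h.mfderiv]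
  rfl

theorem mfderiv_logLik_left (p : M → M → ℝ → ℝ) {x y : M} {σ : ℝ}
    (hd : MDifferentiableAt (paramModel d) 𝓘(ℝ, ℝ) (logLik p x) (y, σ))
    (a : TangentSpace (𝓡 d) y) :
    mfderiv (𝓡 d) 𝓘(ℝ, ℝ) (fun y' : M ↦ logLik p x (y', σ)) y a =
      score p (y, σ) (tangentPair σ a 0) x := by
  have hcurve : HasMFDerivAt (𝓡 d) (paramModel d) (fun y' : M ↦ (y', σ)) y _ :=
    (hasMFDerivAt_id y).prodMk (hasMFDerivAt_const σ y)
  have h : HasMFDerivAt (𝓡 d) 𝓘(ℝ, ℝ) (fun y' : M ↦ logLik p x (y', σ)) y _ :=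
    HasMFDerivAt.comp y (g := logLik p x) hd.hasMFDerivAt hcurve
  rw [h.mfderiv]
  rfl

variable [RiemannianBundle (fun x : M ↦ TangentSpace (𝓡 d) x)]

theorem norm_riemannianGradient_sq {ι : Type*} [Fintype ι] (f : M → ℝ) (y : M)
    (b : OrthonormalBasis ι ℝ (TangentSpace (𝓡 d) y)) {c : ι → ℝ}
    (hc : ∀ i, mfderiv (𝓡 d) 𝓘(ℝ, ℝ) f y (b i) = c i) :
    ‖riemannianGradient (d := d) f y‖ ^ 2 = ∑ i, c i ^ 2 := by
  have : CompleteSpace (TangentSpace (𝓡 d) y) := FiniteDimensional.complete ℝ _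
  rw [← b.sum_sq_norm_inner_left]
  refine Finset.sum_congr rfl fun i _ ↦ ?_
  have h : inner ℝ (riemannianGradient (d := d) f y) (b i) = c i :=
    InnerProductSpace.toDual_symm_apply.trans (hc i)
  rw [h, Real.norm_eq_abs, sq_abs]

variable [MeasurableSpace M] {p : M → M → ℝ → ℝ}

theorem IsRegularModel.integral_deriv_logLik_sq (hp : IsRegularModel d p) (y : M) {σ : ℝ}
    (hσ : 0 < σ) :
    ∫ x, (deriv (fun s : ℝ ↦ logLik p x (y, s)) σ) ^ 2 ∂(law d p (y, σ)) =
      raoFisher p (y, σ) (tangentPair σ (0 : TangentSpace (𝓡 d) y) 1)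
        (tangentPair σ (0 : TangentSpace (𝓡 d) y) 1) := by
  refine integral_congr_ae ?_
  filter_upwards [hp.mdifferentiableAt_logLik y hσ] with x hx
  rw [deriv_logLik p hx, sq]

theorem IsRegularModel.integral_norm_riemannianGradient_sq (hp : IsRegularModel d p) (y : M) {σ : ℝ}
    (hσ : 0 < σ) {ι : Type*} [Fintype ι] (b : OrthonormalBasis ι ℝ (TangentSpace (𝓡 d) y)) :
    ∫ x, ‖riemannianGradient (d := d) (fun y' : M ↦ logLik p x (y', σ)) y‖ ^ 2
        ∂(law d p (y, σ)) =
      ∑ i, raoFisher p (y, σ) (tangentPair σ (b i) 0) (tangentPair σ (b i) 0) := by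
  unfold raoFisher
  rw [← integral_finsetSum _ fun i _ ↦ hp.integrable_score_mul (z := (y, σ)) hσ _ _]
  refine integral_congr_ae ?_
  filter_upwards [hp.mdifferentiableAt_logLik y hσ] with x hx
  rw [norm_riemannianGradient_sq _ y b fun i ↦ mfderiv_logLik_left p hx (b i)]
  exact Finset.sum_congr rfl fun i _ ↦ sq _

end Expectations

/-- The values of a form of class `C^r` on a constant pair of components, along a line
`{y} × (0, ∞)`, are of class `C^r`. -/
theorem IsContMDiffForm.contDiffOn_tangentPair [IsManifold (𝓡 d) ∞ M] {r : ℕ∞}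
    {F : ∀ z : M × ℝ, TangentSpace (paramModel d) z → TangentSpace (paramModel d) z → ℝ}
    (hF : IsContMDiffForm r F) (y : M) (a : TangentSpace (𝓡 d) y) (t : ℝ) :
    ContDiffOn ℝ r (fun σ ↦ F (y, σ) (tangentPair σ a t) (tangentPair σ a t)) (Ioi 0) := by
  let E := EuclideanSpace ℝ (Fin d) × ℝ
  -- The chart of `ℝ` is global, so this trivialization covers the whole line over `y` and uses the
  -- preferred chart at each of its points. The extension `X` of the vector `v` therefore has
  -- constant components `(a, t)` on the line.
  let e := trivializationAt E (TangentSpace (paramModel d)) ((y, 0) : M × ℝ)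
  let v : E := (a, t)
  let X (z : M × ℝ) : TangentSpace (paramModel d) z := e.symm z v
  let U : Set (M × ℝ) := e.baseSet ∩ {z | 0 < z.2}
  have hU : IsOpen U := e.open_baseSet.inter (isOpen_lt continuous_const continuous_snd)
  have hX : ContMDiffOn (paramModel d) (paramModel d).tangent r
      (fun z ↦ (⟨z, X z⟩ : TangentBundle (paramModel d) (M × ℝ))) U := by
    have h : ContMDiffOn (paramModel d) ((paramModel d).prod 𝓘(ℝ, E)) ∞
        (fun z ↦ TotalSpace.mk' E z (X z)) U := by
      rw [e.contMDiffOn_section_iff hU inter_subset_left]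
      refine (contMDiffOn_const (c := v)).congr fun z hz ↦ ?_
      rw [e.apply_mk_symm hz.1]
    exact h.of_le (by exact_mod_cast le_top)
  have hmem (σ : ℝ) : ((y, σ) : M × ℝ) ∈ e.baseSet := by
    change ((y, σ) : M × ℝ) ∈ (chartAt _ ((y, 0) : M × ℝ)).source
    simp [mfld_simps, chartAt_self_eq]
  have hXv (σ : ℝ) : X (y, σ) = tangentPair σ a t := by
    have hsymm : e.symm (y, σ) v = e.symmL ℝ (y, σ) v := (e.symmL_apply (hmem σ) v).symm
    change e.symm (y, σ) v = _
    rw [hsymm, TangentBundle.symmL_trivializationAt_eq_core (hmem σ)]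
    exact (tangentBundleCore (paramModel d) (M × ℝ)).coordChange_self _ _ (hmem σ) _
  have hcurve : ContMDiffOn 𝓘(ℝ, ℝ) (paramModel d) r (fun σ : ℝ ↦ ((y, σ) : M × ℝ)) (Ioi 0) :=
    (contMDiff_const.prodMk contMDiff_id).contMDiffOn
  have h := (hF U hU (fun z hz ↦ hz.2) X X hX hX).comp hcurve fun σ hσ ↦ ⟨hmem σ, hσ⟩
  refine h.contDiffOn.congr fun σ _ ↦ ?_
  simp only [Function.comp_apply, hXv]

end WarpedForm

end WarpedMetrics

end

/-! ### Proof of the theorem on warped metrics -/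

theorem theorem1 {d : ℕ} {M : Type*} [TopologicalSpace M] [T2Space M]
    [SecondCountableTopology M] [Nonempty M]
    [ChartedSpace (EuclideanSpace ℝ (Fin d)) M] [IsManifold (𝓡 d) ∞ M]
    [RiemannianBundle (fun x : M ↦ TangentSpace (𝓡 d) x)]
    [IsContMDiffRiemannianBundle (𝓡 d) ∞ (EuclideanSpace ℝ (Fin d))
      (fun x : M ↦ TangentSpace (𝓡 d) x)]
    [MeasurableSpace M] [BorelSpace M]
    {G : Type*} [Group G] [MulAction G M] [MulAction.IsPretransitive G M]
    (hsmooth : WarpedMetrics.IsSmoothAction d M G)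
    (hmetric : WarpedMetrics.PreservesMetric d M G)
    (hirr : ∀ x : M, (WarpedMetrics.isotropyRepresentation hsmooth x).IsIrreducible)
    (hone : d = 1 → ∀ x : M, ∃ k : MulAction.stabilizer G x,
      WarpedMetrics.isotropyRepresentation hsmooth x k ≠ 1)
    (p : M → M → ℝ → ℝ) (hp : WarpedMetrics.IsRegularModel d p)
    (hinv : ∀ (g : G) (x y : M) (σ : ℝ), 0 < σ → p (g • x) (g • y) σ = p x y σ) :
    ∃ I₀ I₁ : ℝ → ℝ,
      (∀ σ : ℝ, 0 < σ → 0 < I₀ σ ∧ 0 < I₁ σ) ∧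
      (∀ (y : M) (σ : ℝ), 0 < σ →
        I₀ σ = ∫ x, (deriv (fun s : ℝ ↦ WarpedMetrics.logLik p x (y, s)) σ) ^ 2
          ∂(WarpedMetrics.law d p (y, σ))) ∧
      (∀ (y : M) (σ : ℝ), 0 < σ →
        I₁ σ = (∫ x, ‖WarpedMetrics.riemannianGradient (d := d)
          (fun y' : M ↦ WarpedMetrics.logLik p x (y', σ)) y‖ ^ 2
          ∂(WarpedMetrics.law d p (y, σ))) / (d : ℝ)) ∧
      (∀ z : M × ℝ, 0 < z.2 → ∀ v w : TangentSpace (WarpedMetrics.paramModel d) z,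
        WarpedMetrics.raoFisher p z v w = WarpedMetrics.warped I₀ I₁ z v w) ∧
      (∀ r : ℕ∞, WarpedMetrics.IsContMDiffForm r (WarpedMetrics.raoFisher (d := d) p) →
        ContDiffOn ℝ r I₀ (Ioi 0) ∧ ContDiffOn ℝ r I₁ (Ioi 0)) := by
  -- Positivity of `σ` sits inside the existential so that the choice gives functions on all of `ℝ`;
  -- the values for `σ ≤ 0` are irrelevant.
  have hcoef (σ : ℝ) : ∃ i₀ i₁ : ℝ, 0 < σ →
      ∀ (y : M) (a b : TangentSpace (𝓡 d) y) (s t : ℝ),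
        WarpedMetrics.raoFisher p (y, σ) (WarpedMetrics.tangentPair σ a s)
          (WarpedMetrics.tangentPair σ b t) = i₀ * (s * t) + i₁ * inner ℝ a b := by
    by_cases hσ : 0 < σ
    · obtain ⟨i₀, i₁, h⟩ :=
        WarpedMetrics.exists_raoFisher_eq hsmooth hmetric hp hinv hirr hone hσ
      exact ⟨i₀, i₁, fun _ ↦ h⟩
    · exact ⟨0, 0, fun h ↦ absurd h hσ⟩
  choose I₀ I₁ hI using hcoef
  obtain ⟨y₀⟩ := ‹Nonempty M›
  have hfin (y : M) : Module.finrank ℝ (TangentSpace (𝓡 d) y) = d :=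
    finrank_euclideanSpace_fin (𝕜 := ℝ) (n := d)
  -- Irreducibility excludes the zero space. The vector `u` gives `d ≠ 0`, the sign of `I₁`, and
  -- later its regularity.
  obtain ⟨u, hu⟩ : ∃ u : TangentSpace (𝓡 d) y₀, u ≠ 0 := by
    by_contra! hV
    have hne : (⊥ : Subrepresentation (WarpedMetrics.isotropyRepresentation hsmooth y₀)) ≠ ⊤ :=
      (hirr y₀).bot_ne_top
    refine hne (Subrepresentation.toSubmodule_injective (Submodule.ext fun a ↦ ?_))
    rw [hV a]
    simp only [Submodule.zero_mem]
  have hd : (d : ℝ) ≠ 0 := by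
    rintro h
    have h0 : Module.finrank ℝ (TangentSpace (𝓡 d) y₀) = 0 := (hfin y₀).trans (by exact_mod_cast h)
    have hsub := Module.finrank_zero_iff.mp h0
    exact hu (Subsingleton.elim _ _)
  have hI₀ (y : M) {σ : ℝ} (hσ : 0 < σ) :
      WarpedMetrics.raoFisher p (y, σ)
        (WarpedMetrics.tangentPair σ (0 : TangentSpace (𝓡 d) y) 1)
        (WarpedMetrics.tangentPair σ (0 : TangentSpace (𝓡 d) y) 1) = I₀ σ := by
    rw [hI σ hσ, inner_zero_left]
    ring
  have hI₁ {y : M} {σ : ℝ} (hσ : 0 < σ) (a : TangentSpace (𝓡 d) y) :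
      WarpedMetrics.raoFisher p (y, σ) (WarpedMetrics.tangentPair σ a 0)
        (WarpedMetrics.tangentPair σ a 0) = I₁ σ * ‖a‖ ^ 2 := by
    rw [hI σ hσ, real_inner_self_eq_norm_sq]
    ring
  have hupos : 0 < ‖u‖ ^ 2 := by positivity
  refine ⟨I₀, I₁, fun σ hσ ↦ ⟨?_, ?_⟩, fun y σ hσ ↦ ?_, fun y σ hσ ↦ ?_, ?_, fun r hr ↦ ⟨?_, ?_⟩⟩
  · rw [← hI₀ y₀ hσ]
    refine hp.raoFisher_pos (z := (y₀, σ)) hσ fun h ↦ ?_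
    exact one_ne_zero (congrArg (fun v : EuclideanSpace ℝ (Fin d) × ℝ ↦ v.2) h)
  · have h := hp.raoFisher_pos (z := (y₀, σ)) hσ (v := WarpedMetrics.tangentPair σ u 0) fun h ↦
      hu (congrArg (fun v : EuclideanSpace ℝ (Fin d) × ℝ ↦ v.1) h)
    rw [hI₁ hσ] at h
    exact pos_of_mul_pos_left h hupos.le
  · rw [hp.integral_deriv_logLik_sq y hσ, hI₀ y hσ]
  · rw [hp.integral_norm_riemannianGradient_sq y hσ
      (stdOrthonormalBasis ℝ (TangentSpace (𝓡 d) y))]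
    simp only [hI₁ hσ, OrthonormalBasis.norm_eq_one, one_pow, mul_one, Finset.sum_const,
      Finset.card_univ, Fintype.card_fin, nsmul_eq_mul, hfin y]
    exact (mul_div_cancel_left₀ _ hd).symm
  · rintro ⟨y, σ⟩ hσ v w
    obtain ⟨a, s, rfl⟩ := WarpedMetrics.exists_eq_tangentPair v
    obtain ⟨b, t, rfl⟩ := WarpedMetrics.exists_eq_tangentPair w
    unfold WarpedMetrics.warped
    rw [hI σ hσ, WarpedMetrics.dSigma_tangentPair, WarpedMetrics.dSigma_tangentPair,
      WarpedMetrics.mfderiv_fst_tangentPair, WarpedMetrics.mfderiv_fst_tangentPair]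
  · exact (hr.contDiffOn_tangentPair y₀ 0 1).congr fun σ hσ ↦ (hI₀ y₀ hσ).symm
  -- Along the line over `y₀` the norm of `u` is constant in `σ`, so `I₁` is the value of the metric
  -- on `u` divided by a nonzero constant.
  · refine ((hr.contDiffOn_tangentPair y₀ u 0).div_const (‖u‖ ^ 2)).congr fun σ hσ ↦ ?_
    rw [hI₁ hσ, mul_div_cancel_right₀ _ hupos.ne']
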